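/- A quantum graph $G$ is a pair consisting of a finite-dimensional complex inner product space $V(G)$ and a real vector space $E(G)$ of self-adjoint operators on $V(G)$ containing the identity $I$. Its order is $|G|=\dim_{\mathbb C}V(G)$ and its valence is $\|G\|=\dim_{\mathbb R}E(G)-1$. A code of $G$ is a subspace $C\subseteq V(G)$ for which there is a function $\epsilon_C:E(G)\to\mathbb R$ with $P_CAP_C=\epsilon_C(A)P_C$ for all $A\in E(G)$, where $P_C$ is the orthogonal projection onto $C$. A coloring of $G$ is a set $K$ of codes of $G$ with $\sum_{C\in K}P_C=I$, and the chromatic number $\chi(G)$ is the least cardinality of a coloring of $G$. For integers $n,m\ge 0$ with $m+1\le n^2$ (so that quantum graphs of order $n$ and valence $m$ exist), let $\chi(n,m)$ be the maximum of $\chi(G)$ over all quantum graphs $G$ with $|G|=n$ and $\|G\|=m$. Define the step logarithm by $\operatorname{slog}(0,q)=0$ and $\operatorname{slog}(p,q)=\operatorname{slog}(p-\lceil p/q\rceil,q)+1$ for positive integers $p,q$. Theorem. For all integers $n,m\ge 0$ with $m+1\le n^2$, the maximum $\chi(n,m)$ exists and $$\operatorname{slog}(n,m+1)\le\chi(n,m)\le\operatorname{slog}(n,(m+1)^2).$$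 Moreover, for every $m\ge1$, $\operatorname{slog}(n,m+1)\to\infty$ as $n\to\infty$, and there are quantum graphs of valence $m$ with arbitrarily large chromatic number. In particular, there is no function $f:\mathbb N\to\mathbb N$ such that $\chi(G)\le f(\|G\|)$ for all quantum graphs $G$. -/

import Mathlib

universe u

noncomputable section

/-- A quantum graph: a finite-dimensional complex inner product space `V` (the vertex space) with a
real vector space `E` of self-adjoint operators on `V` (the edge space) that contains the
identity. -/
structure QuantumGraph where
  V : Type u
  [normedAddCommGroup : NormedAddCommGroup V]
  [innerProductSpace : InnerProductSpace ℂ V]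
  [finiteDimensional : FiniteDimensional ℂ V]
  E : Submodule ℝ (V →ₗ[ℂ] V)
  isSymmetric : ∀ A ∈ E, A.IsSymmetric
  one_mem : (1 : V →ₗ[ℂ] V) ∈ E

namespace QuantumGraph

attribute [instance] normedAddCommGroup innerProductSpace finiteDimensional

/-- The order: the dimension of the vertex space. -/
def order (G : QuantumGraph.{u}) : ℕ := Module.finrank ℂ G.V

/-- The valence: the (real) dimension of the edge space minus one. The subtraction is genuine as
soon as `V` is not the zero space, since then the identity is a nonzero element of `E`. -/
def valence (G : QuantumGraph.{u}) : ℕ := Module.finrank ℝ G.E - 1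

/-- The orthogonal projection of the vertex space onto a subspace `C`, as an operator. -/
def proj (G : QuantumGraph.{u}) (C : Submodule ℂ G.V) : G.V →ₗ[ℂ] G.V :=
  (C.starProjection : G.V →ₗ[ℂ] G.V)

/-- `C` is a code: `P_C A P_C = ε(A) P_C` for all edges `A` and some real function `ε` on the
edge space. -/
def IsCode (G : QuantumGraph.{u}) (C : Submodule ℂ G.V) : Prop :=
  ∃ ε : G.E → ℝ, ∀ A : G.E,
    G.proj C * (A : G.V →ₗ[ℂ] G.V) * G.proj C = ε A • G.proj C

/-- `K` is a coloring: a set of codes whose projections sum to the identity. -/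
def IsColoring (G : QuantumGraph.{u}) (K : Finset (Submodule ℂ G.V)) : Prop :=
  (∀ C ∈ K, G.IsCode C) ∧ ∑ C ∈ K, G.proj C = 1

/-- The chromatic number: the least cardinality of a coloring (`⊤` if there were none). -/
def chromaticNumber (G : QuantumGraph.{u}) : ℕ∞ :=
  sInf {k : ℕ∞ | ∃ K : Finset (Submodule ℂ G.V), G.IsColoring K ∧ (K.card : ℕ∞) = k}

end QuantumGraph

/-- The chromatic numbers of all quantum graphs of order `n` and valence `m`. -/
def chromaticNumbers (n m : ℕ) : Set ℕ∞ :=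
  {k | ∃ G : QuantumGraph.{u}, G.order = n ∧ G.valence = m ∧ G.chromaticNumber = k}

/-- `χ(n, m)`: the maximum chromatic number among quantum graphs of order `n` and valence `m`. -/
def maxChromaticNumber (n m : ℕ) : ℕ∞ := sSup (chromaticNumbers.{u} n m)

end

/-- The step logarithm: `slog 0 q = 0` and `slog p q = slog (p - ⌈p / q⌉) q + 1` for positive
`p` and `q` (for `q = 0`, where it is not otherwise defined, it is set to `0`). -/
def slog (p q : ℕ) : ℕ :=
  if h : 0 < p ∧ 0 < q then slog (p - p ⌈/⌉ q) q + 1 else 0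
termination_by p
decreasing_by
  have h1 : 0 < p ⌈/⌉ q := by
    rw [Nat.ceilDiv_eq_add_pred_div]
    exact Nat.div_pos (by omega) h.2
  omega

/-
Upper bound. Choose greedily unit vectors in which every edge is diagonal: each vector excludes only
`m + 1` dimensions, so a space of dimension `d` contains `⌈d / (m + 1)⌉` of them. Their expectation
functionals are points of the dual of the edge space, and a Tverberg partition of these points makes
weighted sums over the parts span a code; it has dimension at least `⌈d / (m + 1) ^ 2⌉`. Removing
such codes one after another colors the graph with `slog n ((m + 1) ^ 2)` codes.

Lower bound. Let the `m` edges besides the identity be diagonal with disjoint supports and very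
rapidly decreasing entries. By the min-max principle, a code of dimension greater than `t` only sees
the entries after the first `t` of each edge. A vector orthogonal to all codes of dimension at most
`t` is a sum of at most `n` vectors of larger codes, so unless it vanishes it is not supported on
the first `m * t` basis vectors. Hence the codes of dimension at most `t` have total dimension at
least `min (m * t) n`, and a family of dimensions with this property has at least `slog n (m + 1)`
members.
-/

section Caratheodory

theorem linearIndependent_of_affineIndependent_of_forall_eq {𝕜 E ι : Type*} [Field 𝕜]
    [AddCommGroup E] [Module 𝕜 E] {p : ι → E} (hp : AffineIndependent 𝕜 p) (ℓ : E →ₗ[𝕜] 𝕜) {a : 𝕜}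
    (ha : a ≠ 0) (hℓ : ∀ i, ℓ (p i) = a) : LinearIndependent 𝕜 p := by
  refine linearIndependent_iff'.2 fun s g hg => ?_
  have hsum : (∑ i ∈ s, g i) * a = 0 := by
    simpa only [map_sum, map_smul, hℓ, smul_eq_mul, ← Finset.sum_mul, map_zero] using congrArg ℓ hg
  exact affineIndependent_iff.1 hp s g ((mul_eq_zero.1 hsum).resolve_right ha) hg

theorem exists_mem_convexHull_image_compl_singleton {𝕜 E ι : Type*} [Field 𝕜] [LinearOrder 𝕜]
    [IsStrictOrderedRing 𝕜] [AddCommGroup E] [Module 𝕜 E] [FiniteDimensional 𝕜 E] [Fintype ι]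
    (hι : Module.finrank 𝕜 E < Fintype.card ι) {p : ι → E} {x : E}
    (hx : x ∈ convexHull 𝕜 (Set.range p)) (ℓ : E →ₗ[𝕜] 𝕜) (hℓx : ℓ x ≠ 0)
    (hℓ : ∀ i, ℓ x ≤ ℓ (p i)) : ∃ i, x ∈ convexHull 𝕜 (p '' {i}ᶜ) := by
  obtain ⟨κ, _, y, w, hy, hind, hw0, hw1, hwx⟩ := eq_pos_convex_span_of_mem_convexHull hx
  choose g hg using fun k => hy ⟨k, rfl⟩
  have hsupport : ∀ k, ℓ (y k) = ℓ x := by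
    have hle : ∀ k ∈ Finset.univ, w k * ℓ x ≤ w k * ℓ (y k) := fun k _ =>
      mul_le_mul_of_nonneg_left (hg k ▸ hℓ (g k)) (hw0 k).le
    have heq : ∑ k, w k * ℓ x = ∑ k, w k * ℓ (y k) := by
      rw [← Finset.sum_mul, hw1, one_mul, ← hwx]
      simp only [map_sum, map_smul, smul_eq_mul]
    exact fun k => (mul_left_cancel₀ (hw0 k).ne'
      ((Finset.sum_eq_sum_iff_of_le hle).1 heq k (Finset.mem_univ k))).symm
  have hcard : Fintype.card κ ≤ Module.finrank 𝕜 E :=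
    (linearIndependent_of_affineIndependent_of_forall_eq hind ℓ hℓx
      hsupport).fintype_card_le_finrank
  obtain ⟨i, hi⟩ : ∃ i, ∀ k, g k ≠ i := by
    by_contra! h
    exact (hcard.trans_lt hι).not_ge (Fintype.card_le_of_surjective g h)
  refine ⟨i, hwx ▸ (convex_convexHull 𝕜 _).sum_mem (fun k _ => (hw0 k).le) hw1 fun k _ =>
    subset_convexHull 𝕜 _ ⟨g k, hi k, hg k⟩⟩

variable {F ι : Type*} [NormedAddCommGroup F] [InnerProductSpace ℝ F]

theorem inner_self_le_inner_of_isMinOn_norm {K : Set F} (hK : Convex ℝ K) {z q : F} (hz : z ∈ K)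
    (hmin : IsMinOn norm K z) (hq : q ∈ K) : inner ℝ z z ≤ inner ℝ z q := by
  have hinf : ‖0 - z‖ = ⨅ w : K, ‖0 - (w : F)‖ := by
    simpa only [zero_sub, norm_neg] using (hmin.iInf_eq hz).symm
  have := (norm_eq_iInf_iff_real_inner_le_zero hK hz).1 hinf q hq
  rw [zero_sub, inner_neg_left, inner_sub_right] at this
  linarith

theorem exists_transversal_forall_inner_self_le_inner [Finite ι] [Nonempty ι] {S : ι → Set F}
    (hfin : ∀ i, (S i).Finite) (hne : ∀ i, (S i).Nonempty) :
    ∃ z, (∃ p ∈ Set.univ.pi S, z ∈ convexHull ℝ (Set.range p)) ∧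
      ∀ p ∈ Set.univ.pi S, z ∈ convexHull ℝ (Set.range p) →
        ∀ q ∈ convexHull ℝ (Set.range p), inner ℝ z z ≤ inner ℝ z q := by
  let T : Set F := ⋃ p ∈ Set.univ.pi S, convexHull ℝ (Set.range p)
  have hT : IsCompact T := (Set.Finite.pi fun i => hfin i).isCompact_biUnion fun p _ =>
    (Set.finite_range p).isCompact_convexHull ℝ
  have hTne : T.Nonempty := by
    obtain ⟨p, hp⟩ := Set.univ_pi_nonempty_iff.2 hne
    obtain ⟨x, hx⟩ := (convexHull_nonempty_iff (𝕜 := ℝ)).2 (Set.range_nonempty p)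
    exact ⟨x, Set.mem_biUnion hp hx⟩
  obtain ⟨z, hzT, hzmin⟩ := hT.exists_isMinOn hTne continuous_norm.continuousOn
  refine ⟨z, by simpa only [T, Set.mem_iUnion, exists_prop] using hzT, fun p hp hz q hq => ?_⟩
  exact inner_self_le_inner_of_isMinOn_norm (convex_convexHull ℝ _) hz
    (hzmin.on_subset fun y hy => Set.mem_biUnion hp hy) hq

theorem exists_transversal_zero_mem_convexHull_of_finite [FiniteDimensional ℝ F] [Fintype ι]
    (hι : Module.finrank ℝ F < Fintype.card ι) {S : ι → Set F} (hfin : ∀ i, (S i).Finite)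
    (hS : ∀ i, (0 : F) ∈ convexHull ℝ (S i)) :
    ∃ p ∈ Set.univ.pi S, (0 : F) ∈ convexHull ℝ (Set.range p) := by
  classical
  have : Nonempty ι := Fintype.card_pos_iff.1 (by omega)
  obtain ⟨z, ⟨p, hp, hzp⟩, hmin⟩ := exists_transversal_forall_inner_self_le_inner hfin
    fun i => convexHull_nonempty_iff.1 ⟨0, hS i⟩
  rcases eq_or_ne z 0 with rfl | hz
  · exact ⟨p, hp, hzp⟩
  have hzz : 0 < inner ℝ z z := real_inner_self_pos.2 hz
  -- Trade a point of `p` that `z` does not need for one not on the same side of the origin as `z`.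
  obtain ⟨i, hi⟩ := exists_mem_convexHull_image_compl_singleton hι hzp (innerₛₗ ℝ z) hzz.ne'
    fun i => hmin p hp hzp _ (subset_convexHull ℝ _ ⟨i, rfl⟩)
  obtain ⟨k, hk, hzk⟩ : ∃ k ∈ S i, inner ℝ z k ≤ inner ℝ z 0 :=
    ((innerₛₗ ℝ z).concaveOn (convex_convexHull ℝ (S i))).exists_le_of_mem_convexHull
      (subset_convexHull ℝ _) (hS i)
  have hp' : Function.update p i k ∈ Set.univ.pi S :=
    (Set.update_mem_pi_iff_of_mem hp).2 fun _ => hk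
  have hzp' : z ∈ convexHull ℝ (Set.range (Function.update p i k)) := by
    refine convexHull_mono ?_ hi
    rintro _ ⟨i', hi', rfl⟩
    exact ⟨i', Function.update_of_ne hi' _ _⟩
  have := hmin _ hp' hzp' k (subset_convexHull ℝ _ ⟨i, Function.update_self _ _ _⟩)
  rw [inner_zero_right] at hzk
  linarith

/-- The **colorful Carathéodory theorem**. -/
theorem exists_transversal_zero_mem_convexHull {E : Type*} [AddCommGroup E] [Module ℝ E]
    [FiniteDimensional ℝ E] [Fintype ι] (hι : Module.finrank ℝ E < Fintype.card ι) {S : ι → Set E}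
    (hS : ∀ i, (0 : E) ∈ convexHull ℝ (S i)) :
    ∃ p ∈ Set.univ.pi S, (0 : E) ∈ convexHull ℝ (Set.range p) := by
  have hsub : ∀ i, ∃ t : Finset E, ↑t ⊆ S i ∧ (0 : E) ∈ convexHull ℝ (t : Set E) := fun i => by
    simpa only [convexHull_eq_union_convexHull_finite_subsets (S i), Set.mem_iUnion,
      exists_prop] using hS i
  choose t htS ht using hsub
  let φ : E ≃ₗ[ℝ] EuclideanSpace ℝ (Fin (Module.finrank ℝ E)) :=
    LinearEquiv.ofFinrankEq _ _ (by simp)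
  obtain ⟨p, hp, hp0⟩ := exists_transversal_zero_mem_convexHull_of_finite (S := fun i => φ '' t i)
    (by simpa using hι) (fun i => (t i).finite_toSet.image φ) fun i => by
      rw [← LinearEquiv.coe_coe, ← LinearMap.image_convexHull]
      exact ⟨0, ht i, map_zero _⟩
  choose c hct hcp using fun i => hp i trivial
  refine ⟨c, fun i _ => htS i (hct i), ?_⟩
  rw [← funext hcp, Set.range_comp' φ c, ← LinearEquiv.coe_coe, ← LinearMap.image_convexHull] at hp0
  obtain ⟨x, hx, hx0⟩ := hp0
  rwa [← φ.map_eq_zero_iff.1 hx0]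

end Caratheodory

section Tverberg

theorem mem_convexHull_range_iff {𝕜 E ι : Type*} [Field 𝕜] [LinearOrder 𝕜] [IsStrictOrderedRing 𝕜]
    [AddCommGroup E] [Module 𝕜 E] [Fintype ι] {v : ι → E} {x : E} :
    x ∈ convexHull 𝕜 (Set.range v) ↔ ∃ w ∈ stdSimplex 𝕜 ι, ∑ i, w i • v i = x := by
  classical
  have hv : Set.range v =
      Fintype.linearCombination 𝕜 v '' Set.range fun i => Pi.single i (1 : 𝕜) := by
    rw [← Set.range_comp]
    congr 1
    ext i
    simp [Fintype.linearCombination_apply_single]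
  rw [hv, ← LinearMap.image_convexHull, convexHull_rangle_single_eq_stdSimplex]
  rfl

/-- Coefficients for Sarkaria's tensor trick: the rows of `sarkariaMatrix r` are `r + 1` vectors
in `ℝ ^ r` whose only linear relation, up to scaling, is that their sum vanishes. -/
noncomputable def sarkariaMatrix (r : ℕ) : Matrix (Fin (r + 1)) (Fin r) ℝ := fun s t =>
  (if s = t.castSucc then 1 else 0) - if s = Fin.last r then 1 else 0

theorem sum_sarkariaMatrix (r : ℕ) (t : Fin r) : ∑ s, sarkariaMatrix r s t = 0 := by
  simp [sarkariaMatrix]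

/-- **Tverberg's theorem**, in homogeneous form. -/
theorem exists_tverberg_partition {E ι : Type*} [AddCommGroup E] [Module ℝ E]
    [FiniteDimensional ℝ E] [Fintype ι] {r : ℕ} (h : r * Module.finrank ℝ E < Fintype.card ι)
    (y : ι → E) :
    ∃ j : ι → Fin (r + 1), ∃ w ∈ stdSimplex ℝ ι, ∃ c : E,
      ∀ s, ∑ i with j i = s, w i • y i = c := by
  classical
  let p : ι → Fin (r + 1) → Fin r → E := fun i s t => sarkariaMatrix r s t • y i
  have hp : ∀ i, (0 : Fin r → E) ∈ convexHull ℝ (Set.range (p i)) := fun i => by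
    have hsum : ∑ s, (r + 1 : ℝ)⁻¹ • p i s = 0 := by
      ext t
      simp only [p, ← Finset.smul_sum, Finset.sum_apply, Pi.smul_apply, ← Finset.sum_smul,
        sum_sarkariaMatrix, zero_smul, smul_zero, Pi.zero_apply]
    rw [← hsum]
    refine (convex_convexHull ℝ _).sum_mem (fun _ _ => by positivity) ?_
      fun s _ => subset_convexHull ℝ _ ⟨s, rfl⟩
    rw [Finset.sum_const, Finset.card_univ, Fintype.card_fin, nsmul_eq_mul, Nat.cast_add_one]
    exact mul_inv_cancel₀ (by positivity)
  obtain ⟨q, hq, hq0⟩ := exists_transversal_zero_mem_convexHull (S := fun i => Set.range (p i))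
    (by rwa [Module.finrank_pi_fintype, Finset.sum_const, Finset.card_univ, Fintype.card_fin,
      smul_eq_mul]) hp
  choose j hj using fun i => hq i trivial
  obtain ⟨w, hw, hw0⟩ := mem_convexHull_range_iff.1 hq0
  refine ⟨j, w, hw, ∑ i with j i = Fin.last r, w i • y i, fun s => ?_⟩
  refine Fin.lastCases rfl (fun t => ?_) s
  have ht : ∑ i, w i • sarkariaMatrix r (j i) t • y i = 0 := by
    simpa only [← hj, p, Finset.sum_apply, Pi.smul_apply, Pi.zero_apply] using congrFun hw0 t
  rw [← sub_eq_zero, ← ht, Finset.sum_filter, Finset.sum_filter, ← Finset.sum_sub_distrib]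
  refine Finset.sum_congr rfl fun i _ => ?_
  simp only [sarkariaMatrix, sub_smul, smul_sub, ite_smul, one_smul, zero_smul, smul_ite, smul_zero]

end Tverberg

section StepLogarithm

theorem ceilDiv_pos_of_pos {p q : ℕ} (hp : 0 < p) (hq : 0 < q) : 0 < p ⌈/⌉ q := by
  rw [Nat.ceilDiv_eq_add_pred_div]
  exact Nat.div_pos (by omega) hq

theorem sub_ceilDiv_mono {q : ℕ} (hq : 0 < q) : Monotone fun p : ℕ => p - p ⌈/⌉ q := by
  refine monotone_nat_of_le_succ fun p => ?_
  have h : (p + 1) ⌈/⌉ q ≤ p ⌈/⌉ q + 1 := by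
    rw [ceilDiv_le_iff_le_mul hq, mul_add_one]
    exact Nat.add_le_add (le_smul_ceilDiv hq) hq
  omega

theorem slog_zero (q : ℕ) : slog 0 q = 0 := by
  rw [slog, dif_neg fun h => h.1.false]

theorem slog_of_pos {p q : ℕ} (hp : 0 < p) (hq : 0 < q) :
    slog p q = slog (p - p ⌈/⌉ q) q + 1 := by
  rw [slog, dif_pos ⟨hp, hq⟩]

theorem slog_mono {q : ℕ} (hq : 0 < q) : Monotone fun p => slog p q := by
  intro a b hab
  dsimp only
  induction b using Nat.strong_induction_on generalizing a with
  | _ b ih =>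
    rcases Nat.eq_zero_or_pos a with rfl | ha
    · rw [slog_zero]
      exact Nat.zero_le _
    have hb : 0 < b := ha.trans_le hab
    rw [slog_of_pos ha hq, slog_of_pos hb hq]
    have := ceilDiv_pos_of_pos hb hq
    exact Nat.add_le_add_right (ih (b - b ⌈/⌉ q) (by omega) (sub_ceilDiv_mono hq hab)) 1

theorem slog_sub_add_one_le {p q c : ℕ} (hp : 0 < p) (hq : 0 < q) (hc : p ⌈/⌉ q ≤ c) :
    slog (p - c) q + 1 ≤ slog p q := by
  rw [slog_of_pos hp hq]
  exact Nat.add_le_add_right (slog_mono hq (by omega)) 1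

theorem slog_le_slog_sub_add_one {p q c : ℕ} (hq : 0 < q) (hc : c ≤ p ⌈/⌉ q) :
    slog p q ≤ slog (p - c) q + 1 := by
  rcases Nat.eq_zero_or_pos p with rfl | hp
  · rw [slog_zero]
    exact Nat.zero_le _
  rw [slog_of_pos hp hq]
  exact Nat.add_le_add_right (slog_mono hq (by omega)) 1

theorem tendsto_slog_atTop {q : ℕ} (hq : 2 ≤ q) :
    Filter.Tendsto (fun n => slog n q) Filter.atTop Filter.atTop := by
  have hq0 : 0 < q := by omega
  refine Filter.tendsto_atTop_atTop_of_monotone (slog_mono hq0) fun b => ?_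
  induction b with
  | zero => exact ⟨0, Nat.zero_le _⟩
  | succ b ih =>
    obtain ⟨p, hp⟩ := ih
    have hceil : (2 * p + 2) ⌈/⌉ q ≤ p + 1 := by
      rw [ceilDiv_le_iff_le_mul hq0]
      nlinarith
    refine ⟨2 * p + 2, (Nat.add_le_add_right (hp.trans ?_) 1).trans
      (slog_sub_add_one_le (by omega) hq0 hceil)⟩
    exact slog_mono hq0 (by omega)

theorem slog_sum_le_card {α : Type*} (d : α → ℕ) (m : ℕ) (K : Finset α)
    (h : ∀ t, min (m * t) (∑ C ∈ K, d C) ≤ ∑ C ∈ K with d C ≤ t, d C) :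
    slog (∑ C ∈ K, d C) (m + 1) ≤ K.card := by
  classical
  induction K using Finset.strongInduction with
  | _ K ih =>
    rcases K.eq_empty_or_nonempty with rfl | hK
    · rw [Finset.sum_empty, slog_zero]
      exact Nat.zero_le _
    obtain ⟨C, hC, hmax⟩ := K.exists_max_image d hK
    have hsum := K.sum_erase_add d hC
    have hfilter : ∀ t < d C, {D ∈ K | d D ≤ t} ⊆ K.erase C := fun t ht D hD =>
      Finset.mem_erase.2 ⟨fun hDC => by grind, (Finset.mem_filter.1 hD).1⟩
    have hrec : slog (∑ D ∈ K.erase C, d D) (m + 1) ≤ (K.erase C).card := by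
      refine ih _ (Finset.erase_ssubset hC) fun t => ?_
      rcases lt_or_ge t (d C) with ht | ht
      · refine ((min_le_min_left _ (by omega)).trans (h t)).trans
          (Finset.sum_le_sum_of_subset fun D hD => ?_)
        exact Finset.mem_filter.2 ⟨hfilter t ht hD, (Finset.mem_filter.1 hD).2⟩
      · rw [Finset.filter_true_of_mem fun D hD => (hmax D (Finset.mem_of_mem_erase hD)).trans ht]
        exact min_le_right _ _
    have hceil : d C ≤ (∑ D ∈ K, d D) ⌈/⌉ (m + 1) := by
      by_contra! hlt
      have hpos : 0 < d C := by omega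
      have hle := (h (d C - 1)).trans <|
        Finset.sum_le_sum_of_subset (hfilter _ (Nat.sub_one_lt_of_lt hpos))
      rw [← Nat.le_sub_one_iff_lt hpos, ceilDiv_le_iff_le_mul m.succ_pos, Nat.succ_mul] at hlt
      omega
    calc slog (∑ D ∈ K, d D) (m + 1)
        ≤ slog (∑ D ∈ K, d D - d C) (m + 1) + 1 := slog_le_slog_sub_add_one m.succ_pos hceil
      _ = slog (∑ D ∈ K.erase C, d D) (m + 1) + 1 := by rw [← hsum, Nat.add_sub_cancel]
      _ ≤ K.card := (Nat.add_le_add_right hrec 1).trans_eq (Finset.card_erase_add_one hC)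

end StepLogarithm

section Subspaces

theorem exists_submodule_apply_mem {V ι : Type*} [AddCommGroup V] [Module ℂ V] [Fintype ι]
    (E : Submodule ℝ (V →ₗ[ℂ] V)) [FiniteDimensional ℝ E] (v : ι → V) :
    ∃ U : Submodule ℂ V, Module.finrank ℂ U ≤ Module.finrank ℝ E * Fintype.card ι ∧
      ∀ A ∈ E, ∀ i, A (v i) ∈ U := by
  let b := Module.finBasis ℝ E
  let g : Fin (Module.finrank ℝ E) × ι → V := fun k => (b k.1 : V →ₗ[ℂ] V) (v k.2)
  refine ⟨Submodule.span ℂ (Set.range g), (finrank_range_le_card g).trans_eq ?_, fun A hA i => ?_⟩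
  · rw [Fintype.card_prod, Fintype.card_fin]
  · have hrepr := congrArg (fun T : E => (T : V →ₗ[ℂ] V) (v i)) (b.sum_repr ⟨A, hA⟩)
    simp only [Submodule.coe_sum, Submodule.coe_smul, LinearMap.sum_apply,
      LinearMap.smul_apply] at hrepr
    rw [← hrepr]
    exact Submodule.sum_mem _ fun k _ =>
      Submodule.smul_of_tower_mem _ _ (Submodule.subset_span ⟨(k, i), rfl⟩)

theorem finrank_finset_sup_le_sum {𝕜 V : Type*} [DivisionRing 𝕜] [AddCommGroup V]
    [Module 𝕜 V] [FiniteDimensional 𝕜 V] {ι : Type*} (s : Finset ι) (W : ι → Submodule 𝕜 V) :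
    Module.finrank 𝕜 (s.sup W : Submodule 𝕜 V) ≤ ∑ i ∈ s, Module.finrank 𝕜 (W i) := by
  classical
  induction s using Finset.induction_on with
  | empty => simp
  | insert i s hi ih =>
    rw [Finset.sup_insert, Finset.sum_insert hi]
    exact (Submodule.finrank_add_le_finrank_add_finrank _ _).trans (Nat.add_le_add_left ih _)

end Subspaces

section OrthogonalComplement

variable {𝕜 V : Type*} [RCLike 𝕜] [NormedAddCommGroup V] [InnerProductSpace 𝕜 V]

theorem exists_mem_norm_eq_one_of_finrank_lt [FiniteDimensional 𝕜 V] {U W : Submodule 𝕜 V}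
    (h : Module.finrank 𝕜 U < Module.finrank 𝕜 W) : ∃ x ∈ W, ‖x‖ = 1 ∧ x ∈ Uᗮ := by
  have hne : W ⊓ Uᗮ ≠ ⊥ := fun hbot => by
    have h1 := Submodule.finrank_add_finrank_le_of_disjoint (disjoint_iff.2 hbot)
    have h2 := U.finrank_add_finrank_orthogonal
    omega
  obtain ⟨x, hx, hx0⟩ := Submodule.exists_mem_ne_zero_of_ne_bot hne
  exact ⟨_, W.smul_mem _ hx.1, norm_smul_inv_norm (𝕜 := 𝕜) hx0, Uᗮ.smul_mem _ hx.2⟩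

theorem starProjection_add_starProjection_orthogonal_inf {C W : Submodule 𝕜 V}
    [C.HasOrthogonalProjection] [W.HasOrthogonalProjection] [(Cᗮ ⊓ W).HasOrthogonalProjection]
    (h : C ≤ W) : C.starProjection + (Cᗮ ⊓ W).starProjection = W.starProjection := by
  refine ContinuousLinearMap.ext fun x => ?_
  have hW := W.sub_starProjection_mem_orthogonal x
  have hmem : W.starProjection x - C.starProjection x ∈ Cᗮ ⊓ W := by
    refine ⟨?_, W.sub_mem (W.starProjection_apply_mem x) (h (C.starProjection_apply_mem x))⟩
    rw [← sub_sub_sub_cancel_left _ _ x]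
    exact Cᗮ.sub_mem (C.sub_starProjection_mem_orthogonal x) (Submodule.orthogonal_le h hW)
  have horth : x - (W.starProjection x - C.starProjection x) ∈ (Cᗮ ⊓ W)ᗮ := by
    rw [← sub_add]
    exact Submodule.add_mem _ (Submodule.orthogonal_le inf_le_right hW) <|
      Submodule.orthogonal_le inf_le_left (C.le_orthogonal_orthogonal <|
        C.starProjection_apply_mem x)
  rw [add_apply, Submodule.eq_starProjection_of_mem_orthogonal hmem horth,
    add_sub_cancel]

end OrthogonalComplement

namespace QuantumGraph

section Codes

variable {G : QuantumGraph.{u}} {C : Submodule ℂ G.V}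

theorem proj_apply_mem (C : Submodule ℂ G.V) (x : G.V) : G.proj C x ∈ C :=
  C.starProjection_apply_mem x

theorem proj_eq_self {x : G.V} (hx : x ∈ C) : G.proj C x = x :=
  Submodule.starProjection_eq_self_iff.2 hx

theorem inner_proj_left (C : Submodule ℂ G.V) (x y : G.V) :
    inner ℂ (G.proj C x) y = inner ℂ x (G.proj C y) :=
  C.inner_starProjection_left_eq_right x y

theorem isCode_iff : G.IsCode C ↔ ∃ ε : G.E → ℝ, ∀ A : G.E, ∀ x ∈ C, ∀ y ∈ C,
    inner ℂ x (A.1 y) = ε A * inner ℂ x y := by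
  refine exists_congr fun ε => forall_congr' fun A => ⟨fun h x hx y hy => ?_, fun h => ?_⟩
  · have hxy := congrArg (fun T : G.V →ₗ[ℂ] G.V => inner ℂ x (T y)) h
    simpa only [Module.End.mul_apply, LinearMap.smul_apply, ← inner_proj_left, proj_eq_self hx,
      proj_eq_self hy, ← Complex.coe_smul, inner_smul_right] using hxy
  · refine LinearMap.ext fun y => ext_inner_left ℂ fun x => ?_
    have hxy := h _ (proj_apply_mem C x) _ (proj_apply_mem C y)
    rwa [inner_proj_left, inner_proj_left, proj_eq_self (proj_apply_mem C y),
      ← inner_smul_right, Complex.coe_smul] at hxy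

theorem isCode_span {S : Set G.V} (ε : G.E → ℝ)
    (h : ∀ A : G.E, ∀ x ∈ S, ∀ y ∈ S, inner ℂ x (A.1 y) = ε A * inner ℂ x y) :
    G.IsCode (Submodule.span ℂ S) := by
  refine isCode_iff.2 ⟨ε, fun A x hx y hy => ?_⟩
  induction hx, hy using Submodule.span_induction₂ with
  | mem_mem x y hx hy => exact h A x hx y hy
  | zero_left => simp only [inner_zero_left, mul_zero]
  | zero_right => simp only [map_zero, inner_zero_right, mul_zero]
  | add_left x x' y _ _ _ hx hx' => rw [inner_add_left, inner_add_left, hx, hx', mul_add]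
  | add_right x y y' _ _ _ hy hy' =>
    rw [map_add, inner_add_right, inner_add_right, hy, hy', mul_add]
  | smul_left a x y _ _ h => rw [inner_smul_left, inner_smul_left, h, mul_left_comm]
  | smul_right a x y _ _ h => rw [map_smul, inner_smul_right, inner_smul_right, h, mul_left_comm]

theorem isCode_span_range {ι : Type*} [Fintype ι] [DecidableEq ι] {u : ι → G.V}
    {c : G.E → ℝ} (hc : 0 < c ⟨1, G.one_mem⟩)
    (hu : ∀ A : G.E, ∀ s t, inner ℂ (u s) (A.1 (u t)) = if s = t then (c A : ℂ) else 0) :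
    G.IsCode (Submodule.span ℂ (Set.range u)) ∧
      Module.finrank ℂ (Submodule.span ℂ (Set.range u)) = Fintype.card ι := by
  have hc0 : (c ⟨1, G.one_mem⟩ : ℂ) ≠ 0 := Complex.ofReal_ne_zero.2 hc.ne'
  have hone : ∀ s t, inner ℂ (u s) (u t) = if s = t then (c ⟨1, G.one_mem⟩ : ℂ) else 0 :=
    hu ⟨1, G.one_mem⟩
  refine ⟨isCode_span (fun A => c A / c ⟨1, G.one_mem⟩) ?_, finrank_span_eq_card <|
    linearIndependent_of_ne_zero_of_inner_eq_zero (𝕜 := ℂ) (fun s hs => hc0 ?_)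
      fun s t hst => (hone s t).trans (if_neg hst)⟩
  · rintro A _ ⟨s, rfl⟩ _ ⟨t, rfl⟩
    rw [hu, hone, mul_ite, mul_zero, Complex.ofReal_div, div_mul_cancel₀ _ hc0]
  · have hs' := hone s s
    rwa [hs, inner_zero_left, if_pos rfl, eq_comm] at hs'

end Codes

section DiagonalFamilies

variable {G : QuantumGraph.{u}} {ι : Type*}

/-- A family of unit vectors in which every edge of `G` is diagonal. -/
structure IsDiagonalFamily (G : QuantumGraph.{u}) (v : ι → G.V) : Prop where
  norm_eq_one : ∀ i, ‖v i‖ = 1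
  inner_apply_eq_zero : ∀ A ∈ G.E, ∀ i j, i ≠ j → inner ℂ (v i) (A (v j)) = 0

theorem IsDiagonalFamily.snoc {k : ℕ} {v : Fin k → G.V} (hv : G.IsDiagonalFamily v) {x : G.V}
    (hx : ‖x‖ = 1) (hvx : ∀ A ∈ G.E, ∀ i, inner ℂ (A (v i)) x = 0) :
    G.IsDiagonalFamily (Fin.snoc v x : Fin (k + 1) → G.V) := by
  have hxv : ∀ A ∈ G.E, ∀ i, inner ℂ x (A (v i)) = 0 := fun A hA i =>
    inner_eq_zero_symm.1 (hvx A hA i)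
  have hvx' : ∀ A ∈ G.E, ∀ i, inner ℂ (v i) (A x) = 0 := fun A hA i =>
    (G.isSymmetric A hA _ _).symm.trans (hvx A hA i)
  refine ⟨fun i => ?_, fun A hA i j hij => ?_⟩
  · refine Fin.lastCases ?_ (fun i => ?_) i
    · rwa [Fin.snoc_last]
    · rw [Fin.snoc_castSucc]
      exact hv.norm_eq_one i
  · induction i using Fin.lastCases <;> induction j using Fin.lastCases <;>
      simp_all [hv.inner_apply_eq_zero A hA]

theorem exists_isDiagonalFamily {W : Submodule ℂ G.V} {k : ℕ}
    (hk : k ≤ Module.finrank ℂ W ⌈/⌉ Module.finrank ℝ G.E) :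
    ∃ v : Fin k → G.V, (∀ i, v i ∈ W) ∧ G.IsDiagonalFamily v := by
  induction k with
  | zero => exact ⟨Fin.elim0, fun i => i.elim0, fun i => i.elim0, fun _ _ i => i.elim0⟩
  | succ k ih =>
    obtain ⟨v, hvW, hv⟩ := ih (by omega)
    have hE : 0 < Module.finrank ℝ G.E := Nat.pos_of_ne_zero fun h => by simp [h] at hk
    obtain ⟨U, hU, hvU⟩ := exists_submodule_apply_mem G.E v
    have hUW : Module.finrank ℂ U < Module.finrank ℂ W := by
      refine hU.trans_lt (lt_of_not_ge fun hle => ?_)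
      rw [Fintype.card_fin, ← smul_eq_mul, ← ceilDiv_le_iff_le_smul hE] at hle
      omega
    obtain ⟨x, hxW, hx1, hxU⟩ := exists_mem_norm_eq_one_of_finrank_lt hUW
    refine ⟨Fin.snoc v x, fun i => ?_, hv.snoc hx1 fun A hA i => hxU _ (hvU A hA i)⟩
    refine Fin.lastCases ?_ (fun i => ?_) i
    · rwa [Fin.snoc_last]
    · rw [Fin.snoc_castSucc]
      exact hvW i

/-- The expectation functional `A ↦ ⟪x, A x⟫` of a vector on the edge space. Its values are real,
because edges are self-adjoint. -/
noncomputable def expectation (G : QuantumGraph.{u}) (x : G.V) : Module.Dual ℝ G.E where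
  toFun A := (inner ℂ x (A.1 x)).re
  map_add' A B := by
    rw [Submodule.coe_add, LinearMap.add_apply, inner_add_right, Complex.add_re]
  map_smul' r A := by
    rw [Submodule.coe_smul, LinearMap.smul_apply, ← Complex.coe_smul, inner_smul_right,
      Complex.re_ofReal_mul, RingHom.id_apply, smul_eq_mul]

theorem coe_expectation (x : G.V) (A : G.E) : (G.expectation x A : ℂ) = inner ℂ x (A.1 x) :=
  (G.isSymmetric A.1 A.2).coe_re_inner_self_apply x

theorem IsDiagonalFamily.expectation_one {v : ι → G.V} (hv : G.IsDiagonalFamily v) (i : ι) :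
    G.expectation (v i) ⟨1, G.one_mem⟩ = 1 := by
  refine (inner_self_eq_norm_sq (𝕜 := ℂ) (v i)).trans ?_
  rw [hv.norm_eq_one, one_pow]

theorem IsDiagonalFamily.inner_sum_smul [DecidableEq ι] {v : ι → G.V} (hv : G.IsDiagonalFamily v)
    (A : G.E) (a : ι → ℝ) (s t : Finset ι) :
    inner ℂ (∑ i ∈ s, (a i : ℂ) • v i) (A.1 (∑ i ∈ t, (a i : ℂ) • v i)) =
      ((∑ i ∈ s ∩ t, a i ^ 2 * G.expectation (v i) A : ℝ) : ℂ) := by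
  rw [← Finset.filter_mem_eq_inter, Finset.sum_filter, Complex.ofReal_sum, sum_inner]
  refine Finset.sum_congr rfl fun i _ => ?_
  simp only [map_sum, inner_sum, map_smul, inner_smul_left, inner_smul_right, Complex.conj_ofReal]
  split_ifs with hi
  · rw [Finset.sum_eq_single_of_mem i hi fun j _ hj => by
      rw [hv.inner_apply_eq_zero A.1 A.2 i j hj.symm, mul_zero, mul_zero], Complex.ofReal_mul,
      coe_expectation, Complex.ofReal_pow, sq, mul_assoc]
  · refine Finset.sum_eq_zero fun j hj => ?_
    rw [hv.inner_apply_eq_zero A.1 A.2 i j fun hij => hi (hij ▸ hj), mul_zero, mul_zero]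

theorem IsDiagonalFamily.exists_isCode [Fintype ι] {v : ι → G.V} (hv : G.IsDiagonalFamily v)
    {r : ℕ} (hr : r * Module.finrank ℝ G.E < Fintype.card ι) :
    ∃ C ≤ Submodule.span ℂ (Set.range v), G.IsCode C ∧ Module.finrank ℂ C = r + 1 := by
  classical
  obtain ⟨j, w, hw, c, hc⟩ := exists_tverberg_partition
    (by rwa [Subspace.dual_finrank_eq]) fun i => G.expectation (v i)
  replace hc : ∀ A s, ∑ i with j i = s, w i * G.expectation (v i) A = c A := fun A s => by
    simpa using congrArg (fun f : Module.Dual ℝ G.E => f A) (hc s)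
  let u : Fin (r + 1) → G.V := fun s => ∑ i with j i = s, (√(w i) : ℂ) • v i
  have hu : ∀ A : G.E, ∀ s t, inner ℂ (u s) (A.1 (u t)) = if s = t then (c A : ℂ) else 0 := by
    intro A s t
    rw [hv.inner_sum_smul A fun i => √(w i)]
    simp only [Real.sq_sqrt (hw.1 _)]
    split_ifs with hst
    · rw [hst, Finset.inter_self, hc A t]
    · rw [← Finset.filter_and, Finset.filter_false_of_mem fun i _ h => hst (h.1.symm.trans h.2),
        Finset.sum_empty, Complex.ofReal_zero]
  have hone : ((r + 1 : ℕ) : ℝ) * c ⟨1, G.one_mem⟩ = 1 := by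
    calc _ = ∑ s, ∑ i with j i = s, w i * G.expectation (v i) ⟨1, G.one_mem⟩ := by
          simp only [hc, Finset.sum_const, Finset.card_univ, Fintype.card_fin, nsmul_eq_mul]
      _ = 1 := by
          simp only [hv.expectation_one, mul_one, Finset.sum_fiberwise, hw.2]
  obtain ⟨hcode, hrank⟩ := isCode_span_range
    (pos_of_mul_pos_right (hone ▸ one_pos) (Nat.cast_nonneg _)) hu
  refine ⟨_, Submodule.span_le.2 ?_, hcode, hrank.trans (Fintype.card_fin _)⟩
  rintro _ ⟨s, rfl⟩
  exact Submodule.sum_mem _ fun i _ => Submodule.smul_mem _ _ (Submodule.subset_span ⟨i, rfl⟩)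

/-- The **Knill–Laflamme–Viola theorem**. -/
theorem exists_isCode_ceilDiv_le_finrank {W : Submodule ℂ G.V} (hW : 0 < Module.finrank ℂ W)
    (hE : 0 < Module.finrank ℝ G.E) : ∃ C ≤ W, G.IsCode C ∧
      Module.finrank ℂ W ⌈/⌉ (Module.finrank ℝ G.E) ^ 2 ≤ Module.finrank ℂ C := by
  obtain ⟨v, hvW, hv⟩ := exists_isDiagonalFamily (W := W) le_rfl
  obtain ⟨r, hr⟩ := Nat.exists_eq_add_one.2 (ceilDiv_pos_of_pos hW (pow_pos hE 2))
  have hcard : r * Module.finrank ℝ G.E < Module.finrank ℂ W ⌈/⌉ Module.finrank ℝ G.E := by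
    by_contra! hle
    have : Module.finrank ℂ W ⌈/⌉ Module.finrank ℝ G.E ^ 2 ≤ r := by
      rw [ceilDiv_le_iff_le_mul hE] at hle
      rw [ceilDiv_le_iff_le_mul (pow_pos hE 2)]
      linarith
    omega
  obtain ⟨C, hC, hcode, hrank⟩ := hv.exists_isCode (by rwa [Fintype.card_fin])
  refine ⟨C, hC.trans (Submodule.span_le.2 ?_), hcode, (hr.trans hrank.symm).le⟩
  rintro _ ⟨i, rfl⟩
  exact hvW i

end DiagonalFamilies

section UpperBound

variable {G : QuantumGraph.{u}}

/-- A coloring of a subspace `W`: a set of codes contained in `W` whose projections sum to the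
projection onto `W`. -/
def IsColoringOf (G : QuantumGraph.{u}) (W : Submodule ℂ G.V) (K : Finset (Submodule ℂ G.V)) :
    Prop :=
  (∀ C ∈ K, G.IsCode C ∧ C ≤ W) ∧ ∑ C ∈ K, G.proj C = G.proj W

theorem isColoringOf_bot_empty : G.IsColoringOf ⊥ ∅ := by
  refine ⟨fun C hC => absurd hC (Finset.notMem_empty C), ?_⟩
  rw [Finset.sum_empty, proj, Submodule.starProjection_bot, ContinuousLinearMap.toLinearMap_zero]

theorem IsColoringOf.isColoring {K : Finset (Submodule ℂ G.V)} (hK : G.IsColoringOf ⊤ K) :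
    G.IsColoring K :=
  ⟨fun C hC => (hK.1 C hC).1,
    hK.2.trans (LinearMap.ext fun _ => proj_eq_self Submodule.mem_top)⟩

theorem IsColoringOf.insert [DecidableEq (Submodule ℂ G.V)] {C W : Submodule ℂ G.V}
    {K : Finset (Submodule ℂ G.V)} (hK : G.IsColoringOf (Cᗮ ⊓ W) K) (hC : G.IsCode C)
    (hCW : C ≤ W) (hC0 : C ≠ ⊥) : C ∉ K ∧ G.IsColoringOf W (insert C K) := by
  have hCK : C ∉ K := fun hmem => hC0 <|
    C.orthogonal_disjoint.eq_bot_of_le ((hK.1 C hmem).2.trans inf_le_left)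
  refine ⟨hCK, fun D hD => ?_, ?_⟩
  · rcases Finset.mem_insert.1 hD with rfl | hD
    · exact ⟨hC, hCW⟩
    · exact ⟨(hK.1 D hD).1, (hK.1 D hD).2.trans inf_le_right⟩
  · rw [Finset.sum_insert hCK, hK.2]
    exact congrArg ContinuousLinearMap.toLinearMap
      (starProjection_add_starProjection_orthogonal_inf hCW)

theorem exists_isColoringOf_card_le_slog (hE : 0 < Module.finrank ℝ G.E) (W : Submodule ℂ G.V) :
    ∃ K, G.IsColoringOf W K ∧
      K.card ≤ slog (Module.finrank ℂ W) ((Module.finrank ℝ G.E) ^ 2) := by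
  classical
  induction hw : Module.finrank ℂ W using Nat.strong_induction_on generalizing W with
  | _ w ih =>
    rcases Nat.eq_zero_or_pos w with rfl | hpos
    · obtain rfl := Submodule.finrank_eq_zero.1 hw
      exact ⟨∅, isColoringOf_bot_empty, Nat.zero_le _⟩
    have hE2 : 0 < Module.finrank ℝ G.E ^ 2 := pow_pos hE 2
    obtain ⟨C, hCW, hC, hdim⟩ := exists_isCode_ceilDiv_le_finrank (hw ▸ hpos) hE
    rw [hw] at hdim
    have hC0 : 0 < Module.finrank ℂ C := (ceilDiv_pos_of_pos hpos hE2).trans_le hdim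
    have hadd := Submodule.finrank_add_inf_finrank_orthogonal hCW
    obtain ⟨K, hK, hcard⟩ := ih (w - Module.finrank ℂ C) (by omega) (Cᗮ ⊓ W) (by omega)
    obtain ⟨hCK, hins⟩ := hK.insert hC hCW (Submodule.one_le_finrank_iff.1 hC0)
    refine ⟨_, hins, (Finset.card_insert_of_notMem hCK).trans_le ?_⟩
    exact (Nat.add_le_add_right hcard 1).trans (slog_sub_add_one_le hpos hE2 hdim)

theorem finrank_edge_pos (h : 0 < G.order) : 0 < Module.finrank ℝ G.E := by
  have : Nontrivial G.V := Module.finrank_pos_iff.1 h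
  have : Nontrivial G.E := ⟨⟨0, ⟨1, G.one_mem⟩, fun h => zero_ne_one (congrArg Subtype.val h)⟩⟩
  exact Module.finrank_pos

theorem chromaticNumber_le_slog (h : 0 < G.order) :
    G.chromaticNumber ≤ (slog G.order ((G.valence + 1) ^ 2) : ℕ∞) := by
  have hE := finrank_edge_pos h
  obtain ⟨K, hK, hcard⟩ := exists_isColoringOf_card_le_slog hE ⊤
  rw [finrank_top, ← Nat.sub_add_cancel hE] at hcard
  have hle : G.chromaticNumber ≤ K.card := sInf_le ⟨K, hK.isColoring, rfl⟩
  exact hle.trans (Nat.cast_le.2 hcard)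

end UpperBound

end QuantumGraph

section GeometricBlocks

variable {V : Type*} [NormedAddCommGroup V] [InnerProductSpace ℂ V] {n : ℕ}

/-- The operator that is diagonal in a given orthonormal basis, with given real entries. -/
noncomputable def diagonalOperator (e : OrthonormalBasis (Fin n) ℂ V) (a : Fin n → ℝ) :
    V →ₗ[ℂ] V :=
  ∑ i, (a i : ℂ) • (innerₛₗ ℂ (e i)).smulRight (e i)

theorem inner_diagonalOperator (e : OrthonormalBasis (Fin n) ℂ V) (a : Fin n → ℝ) (x y : V) :
    inner ℂ x (diagonalOperator e a y) = ∑ i, a i * (inner ℂ (e i) y * inner ℂ x (e i)) := by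
  simp only [diagonalOperator, LinearMap.sum_apply, LinearMap.smul_apply,
    LinearMap.smulRight_apply, innerₛₗ_apply_apply, inner_sum, inner_smul_right]

theorem diagonalOperator_isSymmetric (e : OrthonormalBasis (Fin n) ℂ V) (a : Fin n → ℝ) :
    (diagonalOperator e a).IsSymmetric := by
  intro x y
  rw [← inner_conj_symm, inner_diagonalOperator, inner_diagonalOperator, map_sum]
  refine Finset.sum_congr rfl fun i _ => ?_
  simp only [map_mul, Complex.conj_ofReal, inner_conj_symm]
  ring

theorem re_inner_diagonalOperator_self (e : OrthonormalBasis (Fin n) ℂ V) (a : Fin n → ℝ)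
    (x : V) : (inner ℂ x (diagonalOperator e a x)).re = ∑ i, a i * ‖inner ℂ (e i) x‖ ^ 2 := by
  rw [inner_diagonalOperator, Complex.re_sum]
  refine Finset.sum_congr rfl fun i _ => ?_
  rw [Complex.re_ofReal_mul, ← inner_conj_symm x (e i), Complex.mul_conj, Complex.ofReal_re,
    Complex.normSq_eq_norm_sq]

/-- The diagonal operator with entry `δ ^ (i / m)` at the indices `i` congruent to `l` modulo `m`
and `0` elsewhere. For `l < m` these are the edges of the graphs that need many colors. -/
noncomputable def geometricBlock (e : OrthonormalBasis (Fin n) ℂ V) (δ : ℝ) (m l : ℕ) :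
    V →ₗ[ℂ] V :=
  diagonalOperator e fun i => if (i : ℕ) % m = l then δ ^ ((i : ℕ) / m) else 0

/-- The quadratic form of the sum of the blocks `geometricBlock e δ m l` over `l < m`. -/
noncomputable def geometricForm (e : OrthonormalBasis (Fin n) ℂ V) (δ : ℝ) (m : ℕ) (x : V) : ℝ :=
  ∑ i : Fin n, δ ^ ((i : ℕ) / m) * ‖inner ℂ (e i) x‖ ^ 2

variable (e : OrthonormalBasis (Fin n) ℂ V) {δ : ℝ} {m : ℕ}

theorem re_inner_geometricBlock_self (l : ℕ) (x : V) : (inner ℂ x (geometricBlock e δ m l x)).re =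
    ∑ i with ((i : Fin n) : ℕ) % m = l, δ ^ ((i : ℕ) / m) * ‖inner ℂ (e i) x‖ ^ 2 := by
  simp only [geometricBlock, re_inner_diagonalOperator_self, ite_mul, zero_mul, Finset.sum_filter]

theorem sum_re_inner_geometricBlock_self (hm : 0 < m) (x : V) :
    ∑ l ∈ Finset.range m, (inner ℂ x (geometricBlock e δ m l x)).re = geometricForm e δ m x := by
  simp only [re_inner_geometricBlock_self]
  exact Finset.sum_fiberwise_of_maps_to (fun i _ => Finset.mem_range.2 (Nat.mod_lt _ hm)) _

theorem exists_finrank_le_forall_re_inner_geometricBlock_le (hδ : 0 ≤ δ) (hδ1 : δ ≤ 1)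
    (l t : ℕ) : ∃ U : Submodule ℂ V, Module.finrank ℂ U ≤ t ∧
      ∀ x ∈ Uᗮ, (inner ℂ x (geometricBlock e δ m l x)).re ≤ δ ^ t * ‖x‖ ^ 2 := by
  classical
  let S : Finset (Fin n) := {i | (i : ℕ) % m = l ∧ (i : ℕ) / m < t}
  have hS : S.card ≤ t := by
    rw [← Finset.card_range t]
    refine Finset.card_le_card_of_injOn (fun i : Fin n => (i : ℕ) / m) (fun i hi => ?_)
      fun i hi j hj h => ?_
    · exact Finset.mem_coe.2 (Finset.mem_range.2 (Finset.mem_filter.1 hi).2.2)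
    · have hij := (Finset.mem_filter.1 hi).2.1.trans (Finset.mem_filter.1 hj).2.1.symm
      exact Fin.ext (Nat.ext_div_modEq h hij)
  refine ⟨Submodule.span ℂ (S.image e), (finrank_span_finset_le_card _).trans
    (Finset.card_image_le.trans hS), fun x hx => ?_⟩
  rw [re_inner_geometricBlock_self, ← e.sum_sq_norm_inner_right x, Finset.mul_sum]
  refine (Finset.sum_le_sum fun i hi => ?_).trans <|
    Finset.sum_le_sum_of_subset_of_nonneg (Finset.subset_univ _) fun i _ _ => by positivity
  rcases lt_or_ge ((i : ℕ) / m) t with hit | hit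
  · have hiS : i ∈ S := Finset.mem_filter.2 ⟨Finset.mem_univ _, (Finset.mem_filter.1 hi).2, hit⟩
    have hxi : inner ℂ (e i) x = 0 :=
      hx _ (Submodule.subset_span (Finset.mem_coe.2 (Finset.mem_image_of_mem e hiS)))
    simp only [hxi, norm_zero, ne_eq, OfNat.ofNat_ne_zero, not_false_eq_true, zero_pow, mul_zero,
      le_refl]
  · gcongr ?_ * _
    exact pow_le_pow_of_le_one hδ hδ1 hit

theorem geometricForm_sum_le (hδ : 0 ≤ δ) {ι : Type*} (s : Finset ι) (y : ι → V) :
    geometricForm e δ m (∑ j ∈ s, y j) ≤ s.card * ∑ j ∈ s, geometricForm e δ m (y j) := by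
  simp only [geometricForm]
  rw [Finset.sum_comm, Finset.mul_sum]
  refine Finset.sum_le_sum fun i _ => ?_
  rw [← Finset.mul_sum, mul_left_comm, inner_sum]
  gcongr
  exact (pow_le_pow_left₀ (norm_nonneg _) (norm_sum_le _ _) 2).trans sq_sum_le_card_mul_sum_sq

theorem pow_mul_norm_sq_le_geometricForm (hδ : 0 ≤ δ) (hδ1 : δ ≤ 1) {t : ℕ} {x : V}
    (hx : ∀ i : Fin n, m * (t + 1) ≤ i → inner ℂ (e i) x = 0) :
    δ ^ t * ‖x‖ ^ 2 ≤ geometricForm e δ m x := by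
  rw [← e.sum_sq_norm_inner_right x, Finset.mul_sum]
  refine Finset.sum_le_sum fun i _ => ?_
  rcases lt_or_ge (i : ℕ) (m * (t + 1)) with hi | hi
  · gcongr ?_ * _
    exact pow_le_pow_of_le_one hδ hδ1 (Nat.lt_succ_iff.1 (Nat.div_lt_of_lt_mul hi))
  · simp only [hx i hi, norm_zero, ne_eq, OfNat.ofNat_ne_zero, not_false_eq_true, zero_pow,
      mul_zero, le_refl]

theorem exists_finrank_eq_min_forall_inner_eq_zero (k : ℕ) : ∃ W : Submodule ℂ V,
    Module.finrank ℂ W = min k n ∧ ∀ x ∈ W, ∀ i : Fin n, k ≤ i → inner ℂ (e i) x = 0 := by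
  let f : Fin (min k n) → Fin n := Fin.castLE (min_le_right k n)
  have hf : Function.Injective f := Fin.castLE_injective _
  refine ⟨Submodule.span ℂ (Set.range (e ∘ f)), ?_, fun x hx i hi => ?_⟩
  · rw [finrank_span_eq_card (e.orthonormal.comp f hf).linearIndependent, Fintype.card_fin]
  · suffices Submodule.span ℂ (Set.range (e ∘ f)) ≤ (Submodule.span ℂ {e i})ᗮ from
      Submodule.mem_orthogonal_singleton_iff_inner_right.1 (this hx)
    refine Submodule.span_le.2 ?_
    rintro _ ⟨j, rfl⟩
    refine Submodule.mem_orthogonal_singleton_iff_inner_right.2 (e.inner_eq_zero ?_)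
    have hj : (f j : ℕ) < k := j.2.trans_le (min_le_left k n)
    exact fun hij => by omega

end GeometricBlocks

namespace QuantumGraph

section LowerBound

variable {G : QuantumGraph.{u}} {K : Finset (Submodule ℂ G.V)}

theorem finrank_eq_trace_proj (C : Submodule ℂ G.V) :
    LinearMap.trace ℂ G.V (G.proj C) = Module.finrank ℂ C :=
  LinearMap.IsProj.trace ⟨proj_apply_mem C, fun _ => proj_eq_self⟩

theorem IsColoring.sum_finrank (hK : G.IsColoring K) :
    ∑ C ∈ K, Module.finrank ℂ C = G.order := by
  have htrace := congrArg (LinearMap.trace ℂ G.V) hK.2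
  simp only [map_sum, finrank_eq_trace_proj, LinearMap.trace_one] at htrace
  exact_mod_cast htrace

theorem IsColoring.sum_proj_apply (hK : G.IsColoring K) (x : G.V) :
    ∑ C ∈ K, G.proj C x = x := by
  rw [← LinearMap.sum_apply, hK.2, Module.End.one_apply]

theorem IsColoring.sum_norm_sq (hK : G.IsColoring K) (x : G.V) :
    ∑ C ∈ K, ‖G.proj C x‖ ^ 2 = ‖x‖ ^ 2 := by
  calc ∑ C ∈ K, ‖G.proj C x‖ ^ 2 = ∑ C ∈ K, (inner ℂ (G.proj C x) x).re :=
        Finset.sum_congr rfl fun C _ => (C.re_inner_starProjection_eq_normSq x).symm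
    _ = ‖x‖ ^ 2 := by
        rw [← Complex.re_sum, ← sum_inner, hK.sum_proj_apply]
        exact inner_self_eq_norm_sq (𝕜 := ℂ) x

theorem IsCode.re_inner_self_le_of_finrank_lt {C U : Submodule ℂ G.V} (hC : G.IsCode C)
    {A : G.V →ₗ[ℂ] G.V} (hA : A ∈ G.E) (hUC : Module.finrank ℂ U < Module.finrank ℂ C) {β : ℝ}
    (hU : ∀ x ∈ Uᗮ, (inner ℂ x (A x)).re ≤ β * ‖x‖ ^ 2) {y : G.V} (hy : y ∈ C) :
    (inner ℂ y (A y)).re ≤ β * ‖y‖ ^ 2 := by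
  obtain ⟨ε, hε⟩ := isCode_iff.1 hC
  have hself : ∀ x ∈ C, (inner ℂ x (A x)).re = ε ⟨A, hA⟩ * ‖x‖ ^ 2 := fun x hx => by
    rw [hε ⟨A, hA⟩ x hx x hx, Complex.re_ofReal_mul]
    exact congrArg _ (inner_self_eq_norm_sq (𝕜 := ℂ) x)
  obtain ⟨x, hxC, hx1, hxU⟩ := exists_mem_norm_eq_one_of_finrank_lt hUC
  have hεβ := hU x hxU
  rw [hself x hxC, hx1, one_pow, mul_one, mul_one] at hεβ
  rw [hself y hy]
  gcongr

variable {n m : ℕ} {e : OrthonormalBasis (Fin n) ℂ G.V} {δ : ℝ}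

theorem IsCode.geometricForm_le (hm : 0 < m) (hδ : 0 ≤ δ) (hδ1 : δ ≤ 1)
    (hE : ∀ l < m, geometricBlock e δ m l ∈ G.E) {C : Submodule ℂ G.V} (hC : G.IsCode C) {t : ℕ}
    (ht : t < Module.finrank ℂ C) {y : G.V} (hy : y ∈ C) :
    geometricForm e δ m y ≤ m * (δ ^ t * ‖y‖ ^ 2) := by
  have hblock : ∀ l ∈ Finset.range m,
      (inner ℂ y (geometricBlock e δ m l y)).re ≤ δ ^ t * ‖y‖ ^ 2 := fun l hl => by
    obtain ⟨U, hU, hUle⟩ := exists_finrank_le_forall_re_inner_geometricBlock_le e hδ hδ1 l t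
    exact hC.re_inner_self_le_of_finrank_lt (hE l (Finset.mem_range.1 hl)) (hU.trans_lt ht) hUle hy
  rw [← sum_re_inner_geometricBlock_self e hm]
  exact (Finset.sum_le_card_nsmul _ _ _ hblock).trans_eq (by rw [Finset.card_range, nsmul_eq_mul])

theorem IsColoring.card_filter_lt_finrank_le (hK : G.IsColoring K) (t : ℕ) :
    (K.filter fun C : Submodule ℂ G.V => t < Module.finrank ℂ C).card ≤ G.order := by
  rw [← hK.sum_finrank, Finset.card_eq_sum_ones]
  refine le_trans (Finset.sum_le_sum fun C hC => ?_)
    (Finset.sum_le_sum_of_subset (Finset.filter_subset _ K))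
  exact Nat.one_le_of_lt (Finset.mem_filter.1 hC).2

theorem IsColoring.geometricForm_le (hK : G.IsColoring K) (hm : 0 < m) (hδ : 0 ≤ δ) (hδ1 : δ ≤ 1)
    (hE : ∀ l < m, geometricBlock e δ m l ∈ G.E) {t : ℕ} {x : G.V}
    (hx : ∀ C ∈ K, Module.finrank ℂ C ≤ t → G.proj C x = 0) :
    geometricForm e δ m x ≤ G.order * (m * (δ ^ t * ‖x‖ ^ 2)) := by
  let L : Finset (Submodule ℂ G.V) := {C ∈ K | t < Module.finrank ℂ C}
  have hsum : ∑ C ∈ L, G.proj C x = x := by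
    conv_rhs => rw [← hK.sum_proj_apply x]
    exact Finset.sum_filter_of_ne fun C hC hne => lt_of_not_ge fun hle => hne (hx C hC hle)
  calc geometricForm e δ m x = geometricForm e δ m (∑ C ∈ L, G.proj C x) := by rw [hsum]
    _ ≤ L.card * ∑ C ∈ L, geometricForm e δ m (G.proj C x) := geometricForm_sum_le e hδ L _
    _ ≤ L.card * ∑ C ∈ L, m * (δ ^ t * ‖G.proj C x‖ ^ 2) := by
        gcongr with C hC
        obtain ⟨hCK, ht⟩ := Finset.mem_filter.1 hC
        exact (hK.1 C hCK).geometricForm_le hm hδ hδ1 hE ht (proj_apply_mem C x)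
    _ = L.card * (m * (δ ^ t * ∑ C ∈ L, ‖G.proj C x‖ ^ 2)) := by
        rw [← Finset.mul_sum, ← Finset.mul_sum]
    _ ≤ G.order * (m * (δ ^ t * ‖x‖ ^ 2)) := by
        rw [← hK.sum_norm_sq x]
        gcongr
        · exact hK.card_filter_lt_finrank_le t
        · exact Finset.filter_subset _ _

theorem IsColoring.min_le_sum_finrank (hK : G.IsColoring K) (hδ : 0 < δ) (hδ1 : δ ≤ 1)
    (hδnm : G.order * (m * δ) < 1) (hE : ∀ l < m, geometricBlock e δ m l ∈ G.E) (t : ℕ) :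
    min (m * t) n ≤
      ∑ C ∈ K with Module.finrank ℂ (C : Submodule ℂ G.V) ≤ t, Module.finrank ℂ C := by
  rcases Nat.eq_zero_or_pos m with rfl | hm
  · simp only [zero_mul, zero_le, min_eq_left]
  rcases t with _ | t
  · simp only [mul_zero, zero_le, min_eq_left]
  let S : Finset (Submodule ℂ G.V) := {C ∈ K | Module.finrank ℂ C ≤ t + 1}
  obtain ⟨W, hW, hWe⟩ := exists_finrank_eq_min_forall_inner_eq_zero e (m * (t + 1))
  by_contra! hlt
  have hfinrank : Module.finrank ℂ (S.sup id : Submodule ℂ G.V) < Module.finrank ℂ W :=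
    hW.symm ▸ (finrank_finset_sup_le_sum S id).trans_lt hlt
  obtain ⟨x, hxW, hx1, hxS⟩ := exists_mem_norm_eq_one_of_finrank_lt hfinrank
  have hlow := pow_mul_norm_sq_le_geometricForm e hδ.le hδ1 (hWe x hxW)
  have hup := hK.geometricForm_le (t := t + 1) hm hδ.le hδ1 hE (x := x) fun C hC hCt =>
    (C.starProjection_apply_eq_zero_iff).2 <|
      Submodule.orthogonal_le (Finset.le_sup (f := id) (Finset.mem_filter.2 ⟨hC, hCt⟩)) hxS
  rw [hx1] at hlow hup
  have hpow := mul_lt_mul_of_pos_left hδnm (pow_pos hδ t)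
  rw [pow_succ] at hup
  linarith

theorem slog_le_chromaticNumber (hδ : 0 < δ) (hδ1 : δ ≤ 1) (hδnm : G.order * (m * δ) < 1)
    (hE : ∀ l < m, geometricBlock e δ m l ∈ G.E) :
    (slog G.order (m + 1) : ℕ∞) ≤ G.chromaticNumber := by
  have hn : G.order = n := (Module.finrank_eq_card_basis e.toBasis).trans (Fintype.card_fin n)
  refine le_sInf ?_
  rintro _ ⟨K, hK, rfl⟩
  rw [← hK.sum_finrank, Nat.cast_le]
  refine slog_sum_le_card (fun C : Submodule ℂ G.V => Module.finrank ℂ C) m K fun t => ?_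
  rw [hK.sum_finrank, hn]
  exact hK.min_le_sum_finrank hδ hδ1 hδnm hE t

end LowerBound

end QuantumGraph

section Construction

theorem sq_finrank_le_finrank_selfAdjoint (V : Type*) [NormedAddCommGroup V]
    [InnerProductSpace ℂ V] [FiniteDimensional ℂ V] :
    Module.finrank ℂ V ^ 2 ≤ Module.finrank ℝ (selfAdjoint.submodule ℝ (V →ₗ[ℂ] V)) := by
  let H := selfAdjoint.submodule ℝ (V →ₗ[ℂ] V)
  have : FiniteDimensional ℝ (V →ₗ[ℂ] V) := FiniteDimensional.complexToReal _
  have hsurj : Function.Surjective (H.subtype.coprod (Complex.I • H.subtype)) := fun T =>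
    ⟨(⟨_, (realPart T).2⟩, ⟨_, (imaginaryPart T).2⟩), realPart_add_I_smul_imaginaryPart T⟩
  have hle := LinearMap.finrank_le_finrank_of_surjective hsurj
  rw [Module.finrank_prod, finrank_real_of_complex, Module.finrank_linearMap] at hle
  linarith

theorem exists_le_le_finrank_eq {𝕜 W : Type*} [DivisionRing 𝕜] [AddCommGroup W] [Module 𝕜 W]
    [FiniteDimensional 𝕜 W] {E H : Submodule 𝕜 W} (hEH : E ≤ H) {k : ℕ}
    (hE : Module.finrank 𝕜 E ≤ k) (hH : k ≤ Module.finrank 𝕜 H) :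
    ∃ F, E ≤ F ∧ F ≤ H ∧ Module.finrank 𝕜 F = k := by
  induction k, hE using Nat.le_induction with
  | base => exact ⟨E, le_rfl, hEH, rfl⟩
  | succ k _ ih =>
    obtain ⟨F, hEF, hFH, hF⟩ := ih (by omega)
    have hlt : F < H := hFH.lt_of_ne fun h => by rw [h] at hF; omega
    obtain ⟨x, hxH, hxF⟩ := SetLike.exists_of_lt hlt
    refine ⟨F ⊔ Submodule.span 𝕜 {x}, hEF.trans le_sup_left,
      sup_le hFH ((Submodule.span_singleton_le_iff_mem _ _).2 hxH), ?_⟩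
    rw [Submodule.finrank_sup_span_singleton hxF, hF]

theorem QuantumGraph.exists_valence_eq_forall_mem {V : Type u} [NormedAddCommGroup V]
    [InnerProductSpace ℂ V] [FiniteDimensional ℂ V] {m : ℕ} (hm : m + 1 ≤ Module.finrank ℂ V ^ 2)
    (A : Fin m → V →ₗ[ℂ] V) (hA : ∀ l, (A l).IsSymmetric) :
    ∃ E, ∃ (hE : ∀ B ∈ E, B.IsSymmetric) (hone : 1 ∈ E),
      (QuantumGraph.mk V E hE hone).valence = m ∧ ∀ l, A l ∈ E := by
  have : FiniteDimensional ℝ (V →ₗ[ℂ] V) := FiniteDimensional.complexToReal _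
  let v : Fin (m + 1) → V →ₗ[ℂ] V := Fin.cons 1 A
  let E₀ : Submodule ℝ (V →ₗ[ℂ] V) := Submodule.span ℝ (Set.range v)
  have hE₀ : E₀ ≤ selfAdjoint.submodule ℝ (V →ₗ[ℂ] V) := by
    refine Submodule.span_le.2 (Set.range_subset_iff.2 fun l => ?_)
    refine Fin.cases (IsSelfAdjoint.one _) (fun l => ?_) l
    exact (LinearMap.isSymmetric_iff_isSelfAdjoint _).1 (hA l)
  have hcard : Module.finrank ℝ E₀ ≤ m + 1 :=
    (finrank_range_le_card v).trans_eq (Fintype.card_fin _)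
  obtain ⟨E, hE₀E, hE, hdim⟩ := exists_le_le_finrank_eq hE₀ hcard
    (hm.trans (sq_finrank_le_finrank_selfAdjoint V))
  have hv : ∀ l, v l ∈ E := fun l => hE₀E (Submodule.subset_span ⟨l, rfl⟩)
  exact ⟨E, fun B hB => (LinearMap.isSymmetric_iff_isSelfAdjoint _).2 (hE hB), hv 0,
    (congrArg (· - 1) hdim).trans (Nat.add_sub_cancel m 1), fun l => hv l.succ⟩

theorem exists_slog_le_chromaticNumber {n m : ℕ} (h : m + 1 ≤ n ^ 2) :
    ∃ G : QuantumGraph.{u}, G.order = n ∧ G.valence = m ∧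
      (slog n (m + 1) : ℕ∞) ≤ G.chromaticNumber := by
  let V : Type u := EuclideanSpace ℂ (ULift.{u} (Fin n))
  have hV : Module.finrank ℂ V = n := by simp [V]
  let e : OrthonormalBasis (Fin n) ℂ V := (stdOrthonormalBasis ℂ V).reindex (finCongr hV)
  let δ : ℝ := (n * m + 1)⁻¹
  have hδ : (1 : ℝ) ≤ n * m + 1 := le_add_of_nonneg_left (by positivity)
  obtain ⟨E, hE, hone, hvalence, hmem⟩ := QuantumGraph.exists_valence_eq_forall_mem (hV.symm ▸ h)
    (fun l : Fin m => geometricBlock e δ m l) fun l => diagonalOperator_isSymmetric e _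
  let G : QuantumGraph.{u} := ⟨V, E, hE, hone⟩
  have hn : G.order = n := hV
  have hδnm : G.order * (m * δ) < 1 := by
    rw [hn, ← mul_assoc, ← div_eq_mul_inv, div_lt_one (one_pos.trans_le hδ)]
    exact lt_add_one _
  refine ⟨G, hn, hvalence, hn ▸ QuantumGraph.slog_le_chromaticNumber (G := G) (e := e)
    (inv_pos.2 (one_pos.trans_le hδ)) (inv_le_one_of_one_le₀ hδ) hδnm fun l hl => hmem ⟨l, hl⟩⟩

end Construction

section MaxChromaticNumber

variable {n m : ℕ}

theorem maxChromaticNumber_le_slog (hn : 0 < n) :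
    maxChromaticNumber.{u} n m ≤ (slog n ((m + 1) ^ 2) : ℕ∞) := by
  refine sSup_le ?_
  rintro _ ⟨G, rfl, rfl, rfl⟩
  exact QuantumGraph.chromaticNumber_le_slog hn

theorem slog_le_maxChromaticNumber (h : m + 1 ≤ n ^ 2) :
    (slog n (m + 1) : ℕ∞) ≤ maxChromaticNumber.{u} n m := by
  obtain ⟨G, hn, hm, hG⟩ := exists_slog_le_chromaticNumber.{u} h
  exact hG.trans (le_sSup ⟨G, hn, hm, rfl⟩)

theorem isGreatest_maxChromaticNumber (h : m + 1 ≤ n ^ 2) :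
    IsGreatest (chromaticNumbers.{u} n m) (maxChromaticNumber.{u} n m) := by
  have hn : 0 < n := Nat.pos_of_ne_zero fun hn => by simp [hn] at h
  obtain ⟨G, hGn, hGm, -⟩ := exists_slog_le_chromaticNumber.{u} h
  have : Nonempty (chromaticNumbers.{u} n m) := ⟨⟨_, G, hGn, hGm, rfl⟩⟩
  exact ⟨ENat.sSup_mem_of_nonempty_of_lt_top <|
    (maxChromaticNumber_le_slog hn).trans_lt (ENat.natCast_lt_top _), fun _ => le_sSup⟩

theorem exists_lt_chromaticNumber (hm : 1 ≤ m) (b : ℕ) :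
    ∃ G : QuantumGraph.{u}, G.valence = m ∧ (b : ℕ∞) < G.chromaticNumber := by
  obtain ⟨n, hb, hn⟩ :=
    (((tendsto_slog_atTop (Nat.succ_le_succ hm)).eventually_gt_atTop b).and
      (Filter.eventually_ge_atTop (m + 1))).exists
  obtain ⟨G, -, hG, hχ⟩ :=
    exists_slog_le_chromaticNumber.{u} (hn.trans (Nat.le_self_pow two_ne_zero n))
  exact ⟨G, hG, (Nat.cast_lt.2 hb).trans_le hχ⟩

end MaxChromaticNumber

theorem theorem2 :
    (∀ n m : ℕ, m + 1 ≤ n ^ 2 →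
      IsGreatest (chromaticNumbers.{u} n m) (maxChromaticNumber.{u} n m) ∧
      (slog n (m + 1) : ℕ∞) ≤ maxChromaticNumber.{u} n m ∧
      maxChromaticNumber.{u} n m ≤ (slog n ((m + 1) ^ 2) : ℕ∞)) ∧
    (∀ m : ℕ, 1 ≤ m → Filter.Tendsto (fun n => slog n (m + 1)) Filter.atTop Filter.atTop) ∧
    (∀ m : ℕ, 1 ≤ m → ∀ b : ℕ, ∃ G : QuantumGraph.{u},
      G.valence = m ∧ (b : ℕ∞) < G.chromaticNumber) ∧
    ¬ ∃ f : ℕ → ℕ, ∀ G : QuantumGraph.{u}, G.chromaticNumber ≤ (f G.valence : ℕ∞) := by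
  refine ⟨fun n m h => ⟨isGreatest_maxChromaticNumber h, slog_le_maxChromaticNumber h,
      maxChromaticNumber_le_slog (Nat.pos_of_ne_zero fun hn => by simp [hn] at h)⟩,
    fun m hm => tendsto_slog_atTop (Nat.succ_le_succ hm),
    fun m hm b => exists_lt_chromaticNumber hm b, ?_⟩
  rintro ⟨f, hf⟩
  obtain ⟨G, hG, hlt⟩ := exists_lt_chromaticNumber.{u} le_rfl (f 1)
  exact absurd (hf G) (not_le.2 (hG ▸ hlt))
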